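/- \textbf{Conventions.} A schema is a finite set of relation symbols with arities. All structures are finite; the empty universe is allowed. A problem over a schema $\sigma$ is an isomorphism-closed set of finite $\sigma$-structures; it is FO-definable if it is the set of finite models of some first-order sentence over $\sigma$. For a $\sigma$-structure $\mathcal S$ and a subset $A$ of its universe, $\mathrm{tp}_{\mathcal S}(A)$ is the isomorphism type of the substructure of $\mathcal S$ induced by $A$. For a map $\pi$ put $\hat\pi(A,j)=(\pi(A),j)$. \textbf{Cookbook reductions.} A cookbook reduction from $\sigma$-structures to $\sigma^\star$-structures is a finite set $\rho=\{(\mathfrak t_1,\mathfrak S_1),\dots,(\mathfrak t_m,\mathfrak S_m)\}$, where the $\mathfrak t_i$ are pairwise non-isomorphic $\sigma$-structures with universes $[k_i]=\{1,\dots,k_i\}$, $k_i\ge 0$ (they, and their isomorphism types, form the support of $\rho$), and the $\mathfrak S_i$ are finite $\sigma^\star$-structures, such that for every $(\mathfrak t,\mathfrak S)\in\rho$, with $\mathfrak t$ on $[k]$: (P1) the elements of $\mathfrak S$ are pairs $(A,j)$ with $A\subseteq[k]$, $j\ge1$, and with $(A,j)$ also $(A,1),\dots,(A,j-1)$ are elements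 of $\mathfrak S$; (P2) if $(A,j)$ is an element of $\mathfrak S$ and $A\subsetneq[k]$, then there is $(\mathfrak t',\mathfrak S')\in\rho$ such that $\mathrm{tp}_{\mathfrak t}(A)$ is the type of $\mathfrak t'$ and $(\{1,\dots,|A|\},j)$ is an element of $\mathfrak S'$; (P3) if $((A_1,j_1),\dots,(A_\ell,j_\ell))$ is in a relation of $\mathfrak S$ and $\bigcup_iA_i\subsetneq[k]$, then $\mathrm{tp}_{\mathfrak t}(\bigcup_iA_i)$ is in the support; (P4) for all $(\mathfrak t',\mathfrak S')\in\rho$ and $A\subsetneq[k]$ such that $\mathrm{tp}_{\mathfrak t}(A)$ is the type of $\mathfrak t'$, there is an isomorphism $\pi$ from $\mathfrak t'$ to $\mathfrak t|_A$ such that $\hat\pi$ is an embedding of $\mathfrak S'$ into $\mathfrak S$ (as an induced substructure); and such that (P5) for every $\sigma$-structure $\mathcal S$ the set $\rho(\mathcal S)$ is non-empty and consists of pairwise isomorphic structures. Here $\rho(\mathcal S)$ is the set of all $\sigma^\star$-structures $\mathcal S^\star$ such that (S1) the elements of $\mathcal S^\star$ are exactly the pairs $(A,j)$, with $A$ a subset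 of the universe of $\mathcal S$, for which there is $(\mathfrak t,\mathfrak S)\in\rho$ such that $\mathrm{tp}_{\mathcal S}(A)$ is the type of $\mathfrak t$ and $(\{1,\dots,|A|\},j)$ is an element of $\mathfrak S$; (S2) if $((A_1,j_1),\dots,(A_\ell,j_\ell))$ is in a relation of $\mathcal S^\star$, then $\mathrm{tp}_{\mathcal S}(\bigcup_iA_i)$ is in the support; (S3) for all $(\mathfrak t,\mathfrak S)\in\rho$ and every $A$ such that $\mathrm{tp}_{\mathcal S}(A)$ is the type of $\mathfrak t$, there is an isomorphism $\pi$ from $\mathfrak t$ to $\mathcal S|_A$ such that $\hat\pi$ is an embedding of $\mathfrak S$ into $\mathcal S^\star$. The arity of $\rho$ is the largest universe size of a structure in its support. The reduction $\rho$ is a reduction from a problem $P$ over $\sigma$ to a problem $P^\star$ over $\sigma^\star$ if for every $\sigma$-structure $\mathcal S$ and every $\mathcal S^\star\in\rho(\mathcal S)$ (equivalently, for some such $\mathcal S^\star$) we have $\mathcal S\in P\iff\mathcal S^\star\in P^\star$. \textbf{Theorem.} Let $\sigma,\sigma^\star$ be schemas, let $r>0$, let $P$ be an arbitrary problem over $\sigma$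 (not necessarily decidable) and let $P^\star$ be an FO-definable problem over $\sigma^\star$. Then there is an algorithm, depending on $\sigma,\sigma^\star,r,P,P^\star$, that always halts and that, given a cookbook reduction $\rho$ from $\sigma$-structures to $\sigma^\star$-structures of arity at most $r$ as an explicit list of its instructions $(\mathfrak t_i,\mathfrak S_i)$, decides whether $\rho$ is a reduction from $P$ to $P^\star$. -/

import Mathlib

open FirstOrder

namespace Cookbook

/-- A finite, purely relational schema: finitely many relation symbols, each with its arity. -/
structure Schema where
  num : ℕ
  ar : Fin num → ℕ

/-- The relation symbols of a schema, as a family indexed by the arity. -/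
inductive Schema.Rel (σ : Schema) : ℕ → Type
  | sym (i : Fin σ.num) : Schema.Rel σ (σ.ar i)

/-- The first-order language of a schema. It has no function symbols. -/
def Schema.lang (σ : Schema) : FirstOrder.Language.{0, 0} := ⟨fun _ => Empty, σ.Rel⟩

/-- A finite `σ`-structure. The universe may be empty. -/
structure FinStr (σ : Schema) where
  carrier : Type
  finite : Finite carrier
  rel : ∀ i : Fin σ.num, Set (Fin (σ.ar i) → carrier)

instance {σ : Schema} : CoeSort (FinStr σ) Type := ⟨FinStr.carrier⟩

/-- The interpretation of the relation symbols in a finite structure. -/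
def FinStr.interp {σ : Schema} (S : FinStr σ) : ∀ {n : ℕ}, σ.Rel n → (Fin n → S) → Prop
  | _, .sym i, x => x ∈ S.rel i

instance {σ : Schema} (S : FinStr σ) : σ.lang.Structure S where
  funMap f := Empty.elim f
  RelMap R x := S.interp R x

/-- An algorithmic problem: an isomorphism-closed set of finite `σ`-structures. -/
structure Problem (σ : Schema) where
  instances : Set (FinStr σ)
  iso_closed : ∀ S T : FinStr σ, Nonempty (S ≃[σ.lang] T) → S ∈ instances → T ∈ instances

/-- A problem is FO-definable if it is the set of finite models of a first-order sentence. -/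
def Problem.FODefinable {σ : Schema} (P : Problem σ) : Prop :=
  ∃ φ : σ.lang.Sentence, ∀ S : FinStr σ, S ∈ P.instances ↔ (S : Type) ⊨ φ

/-- A finite `τ`-structure whose elements are pairs `(A, j)` with `A ⊆ U` and `j ∈ ℕ`. -/
@[ext] structure PairStr (τ : Schema) (U : Type) where
  univ : Set (Set U × ℕ)
  finite : univ.Finite
  rel : ∀ i : Fin τ.num, Set (Fin (τ.ar i) → Set U × ℕ)
  rel_mem : ∀ i, ∀ x ∈ rel i, ∀ l, x l ∈ univ

/-- The same structure, with its universe as a type. -/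
def PairStr.toFinStr {τ : Schema} {U : Type} (T : PairStr τ U) : FinStr τ where
  carrier := T.univ
  finite := T.finite.to_subtype
  rel i := {x | (fun l => (x l : Set U × ℕ)) ∈ T.rel i}

/-- An instruction `(t, S)`: the structure `t` has universe `[k]`, here `{0, …, k - 1}`, and
the elements of `S` are pairs `(A, j)` with `A ⊆ [k]`. -/
structure Instruction (σ τ : Schema) where
  k : ℕ
  trel : ∀ i : Fin σ.num, Set (Fin (σ.ar i) → Fin k)
  S : PairStr τ (Fin k)

/-- The structure `t` of an instruction. -/
def Instruction.t {σ τ : Schema} (I : Instruction σ τ) : FinStr σ where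
  carrier := Fin I.k
  finite := inferInstanceAs (Finite (Fin I.k))
  rel := I.trel

/-- `tp_S(A) = t`: the substructure of `S` induced by `A` is isomorphic to `t`, that is, some
embedding of `t` into `S` has range `A`. -/
def HasType {σ : Schema} (S : FinStr σ) (A : Set S) (t : FinStr σ) : Prop :=
  ∃ π : t ↪[σ.lang] S, Set.range π = A

/-- The map `(A, j) ↦ (π(A), j)`. -/
def hat {U V : Type} (π : U → V) (e : Set U × ℕ) : Set V × ℕ := (π '' e.1, e.2)

/-- The map `(A, j) ↦ (π(A), j)` is an embedding of `T` into `T'`. -/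
def HatIsEmbedding {τ : Schema} {U V : Type} (π : U → V) (T : PairStr τ U) (T' : PairStr τ V) :
    Prop :=
  ∃ F : T.toFinStr ↪[τ.lang] T'.toFinStr, ∀ e : T.univ, (F e).1 = hat π e.1

section Semantics

variable {σ τ : Schema}

/-- The type of `A` in `S` is in the support of `ρ`. -/
def InSupport (ρ : Set (Instruction σ τ)) (S : FinStr σ) (A : Set S) : Prop :=
  ∃ I ∈ ρ, HasType S A I.t

/-- The set `ρ(S)` of target structures that are produced from the source structure `S`. -/
structure Produces (ρ : Set (Instruction σ τ)) (S : FinStr σ) (T : PairStr τ S) : Prop where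
  s1 : ∀ (A : Set S) (j : ℕ), (A, j) ∈ T.univ ↔
    ∃ I ∈ ρ, HasType S A I.t ∧ ((Set.univ : Set (Fin I.k)), j) ∈ I.S.univ
  s2 : ∀ i, ∀ x ∈ T.rel i, InSupport ρ S (⋃ l, (x l).1)
  s3 : ∀ I ∈ ρ, ∀ A : Set S, HasType S A I.t →
    ∃ π : I.t ↪[σ.lang] S, Set.range π = A ∧ HatIsEmbedding π I.S T

/-- `ρ` is a cookbook reduction from `σ`-structures to `τ`-structures. -/
structure IsCookbookReduction (ρ : Set (Instruction σ τ)) : Prop where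
  finite : ρ.Finite
  distinct : ∀ I ∈ ρ, ∀ J ∈ ρ, Nonempty (I.t ≃[σ.lang] J.t) → I = J
  p1 : ∀ I ∈ ρ, ∀ A j, (A, j) ∈ I.S.univ → 1 ≤ j ∧ ∀ j', 1 ≤ j' → j' < j → (A, j') ∈ I.S.univ
  p2 : ∀ I ∈ ρ, ∀ A j, (A, j) ∈ I.S.univ → A ≠ Set.univ →
    ∃ I' ∈ ρ, HasType I.t A I'.t ∧ ((Set.univ : Set (Fin I'.k)), j) ∈ I'.S.univ
  p3 : ∀ I ∈ ρ, ∀ i, ∀ x ∈ I.S.rel i, (⋃ l, (x l).1) ≠ Set.univ →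
    InSupport ρ I.t (⋃ l, (x l).1)
  p4 : ∀ I ∈ ρ, ∀ I' ∈ ρ, ∀ A : Set (Fin I.k), A ≠ Set.univ → HasType I.t A I'.t →
    ∃ π : I'.t ↪[σ.lang] I.t, Set.range π = A ∧ HatIsEmbedding π I'.S I.S
  p5 : ∀ S : FinStr σ, (∃ T, Produces ρ S T) ∧
    ∀ T T', Produces ρ S T → Produces ρ S T' → Nonempty (T.toFinStr ≃[τ.lang] T'.toFinStr)

/-- All types in the support of `ρ` have arity at most `r`. -/
def ArityLE (ρ : Set (Instruction σ τ)) (r : ℕ) : Prop := ∀ I ∈ ρ, I.k ≤ r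

/-- `ρ` is a reduction from `P` to `Q`. For a cookbook reduction the structures in `ρ(S)` are
isomorphic and there is at least one, so it does not matter which of them is considered. -/
def IsReduction (ρ : Set (Instruction σ τ)) (P : Problem σ) (Q : Problem τ) : Prop :=
  ∀ (S : FinStr σ) (T : PairStr τ S), Produces ρ S T →
    (S ∈ P.instances ↔ T.toFinStr ∈ Q.instances)

end Semantics

/-! ### Explicit representation of instructions and cookbook reductions -/

/-- A pair `(A, j)`, where the finite set `A` is given by a list of its elements. -/
abbrev PairCode := List ℕ × ℕ

/-- An instruction `(t, S)`, given by the size of the universe of `t`, the list of the facts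
`(i, x)` that hold in `t` (`i` is the index of a relation symbol and `x` is a tuple), the list of
the elements of `S`, and the list of the facts that hold in `S`. -/
abbrev InstructionCode :=
  ℕ × List (ℕ × List ℕ) × List PairCode × List (ℕ × List PairCode)

/-- A finite set of instructions, given as a list. -/
abbrev ReductionCode := List InstructionCode

/-- The pair that is represented by a code. -/
def PairCode.decode (k : ℕ) (e : PairCode) : Set (Fin k) × ℕ := ({a | (a : ℕ) ∈ e.1}, e.2)

/-- The instruction that is represented by a code. Listed facts that use indices or elements that
do not exist are ignored. -/
def InstructionCode.decode (σ τ : Schema) (c : InstructionCode) : Instruction σ τ where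
  k := c.1
  trel i := {x | ((i : ℕ), List.ofFn fun l => (x l : ℕ)) ∈ c.2.1}
  S :=
    { univ := {e | ∃ d ∈ c.2.2.1, PairCode.decode c.1 d = e}
      finite := (List.finite_toSet c.2.2.1).image (PairCode.decode c.1)
      rel := fun i => {x | (∀ l, ∃ d ∈ c.2.2.1, PairCode.decode c.1 d = x l) ∧
        ∃ ds : List PairCode, ((i : ℕ), ds) ∈ c.2.2.2 ∧
          ds.map (PairCode.decode c.1) = List.ofFn x}
      rel_mem := fun _ _ hx => hx.1 }

/-- The set of instructions that is represented by a code. -/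
def ReductionCode.decode (σ τ : Schema) (c : ReductionCode) : Set (Instruction σ τ) :=
  {I | ∃ d ∈ c, InstructionCode.decode σ τ d = I}

section Coverage

theorem PairCode.exists_decode (k : ℕ) : ∃ g : Set (Fin k) × ℕ → PairCode,
    ∀ e, PairCode.decode k (g e) = e := by
  classical
  refine ⟨fun e => (((List.finRange k).filter (fun a => a ∈ e.1)).map Fin.val, e.2), ?_⟩
  rintro ⟨A, j⟩
  simp only [PairCode.decode, Prod.mk.injEq, and_true]
  ext a
  simp [Fin.val_inj]

/-- Every instruction is represented by a code. -/
theorem InstructionCode.exists_decode {σ τ : Schema} (I : Instruction σ τ) :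
    ∃ c : InstructionCode, InstructionCode.decode σ τ c = I := by
  classical
  obtain ⟨k, trel, ⟨U, hU, R, hR⟩⟩ := I
  obtain ⟨g, hg⟩ := PairCode.exists_decode k
  have h1 : Set.Finite {p : ℕ × List ℕ | ∃ i : Fin σ.num, ∃ x ∈ trel i,
      ((i : ℕ), List.ofFn fun l => (x l : ℕ)) = p} := by
    refine (Set.finite_iUnion fun i : Fin σ.num => (Set.toFinite (trel i)).image
      fun x => ((i : ℕ), List.ofFn fun l => (x l : ℕ))).subset ?_
    rintro p ⟨i, x, hx, rfl⟩
    exact Set.mem_iUnion.2 ⟨i, x, hx, rfl⟩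
  have h2 : Set.Finite {p : ℕ × List PairCode | ∃ i : Fin τ.num, ∃ x ∈ R i,
      ((i : ℕ), List.ofFn fun l => g (x l)) = p} := by
    have hfin : ∀ i, (R i).Finite := fun i =>
      (Set.Finite.pi' fun _ : Fin (τ.ar i) => hU).subset fun x hx l => hR i x hx l
    refine (Set.finite_iUnion fun i : Fin τ.num => (hfin i).image
      fun x => ((i : ℕ), List.ofFn fun l => g (x l))).subset ?_
    rintro p ⟨i, x, hx, rfl⟩
    exact Set.mem_iUnion.2 ⟨i, x, hx, rfl⟩
  have hel : ∀ e, (∃ d ∈ (hU.image g).toFinset.toList, PairCode.decode k d = e) ↔ e ∈ U := by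
    intro e
    simp only [Finset.mem_toList, Set.Finite.mem_toFinset, Set.mem_image]
    constructor
    · rintro ⟨_, ⟨e', he', rfl⟩, rfl⟩
      rwa [hg]
    · intro he
      exact ⟨_, ⟨e, he, rfl⟩, hg e⟩
  refine ⟨(k, h1.toFinset.toList, (hU.image g).toFinset.toList, h2.toFinset.toList), ?_⟩
  simp only [InstructionCode.decode, Instruction.mk.injEq, heq_eq_eq, true_and]
  refine ⟨?_, ?_⟩
  · funext i
    ext x
    simp only [Finset.mem_toList, Set.Finite.mem_toFinset, Set.mem_ofPred_eq, Prod.mk.injEq]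
    constructor
    · rintro ⟨i', x', hx', hi, hxx⟩
      obtain rfl := Fin.ext hi
      have := List.ofFn_injective hxx
      have : x' = x := funext fun l => Fin.ext (congrFun this l)
      exact this ▸ hx'
    · intro hx
      exact ⟨i, x, hx, rfl, rfl⟩
  · ext1
    · ext e
      exact hel e
    · funext i
      ext x
      simp only [Set.mem_ofPred_eq, hel]
      simp only [Finset.mem_toList, Set.Finite.mem_toFinset, Set.mem_ofPred_eq, Prod.mk.injEq]
      constructor
      · rintro ⟨-, ds, ⟨i', x', hx', hi, rfl⟩, hds⟩
        obtain rfl := Fin.ext hi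
        rw [List.map_ofFn] at hds
        have := List.ofFn_injective hds
        have : x' = x := by
          rw [← this]
          funext l
          simp [hg]
        exact this ▸ hx'
      · intro hx
        refine ⟨fun l => hR i x hx l, _, ⟨i, x, hx, rfl, rfl⟩, ?_⟩
        rw [List.map_ofFn]
        congr 1
        funext l
        simp [hg]

/-- Every finite set of instructions, in particular every cookbook reduction, is represented by
a code. -/
theorem ReductionCode.exists_decode {σ τ : Schema} (ρ : Set (Instruction σ τ)) (h : ρ.Finite) :
    ∃ c : ReductionCode, ReductionCode.decode σ τ c = ρ := by
  classical
  choose g hg using fun I : Instruction σ τ => InstructionCode.exists_decode I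
  refine ⟨(h.image g).toFinset.toList, ?_⟩
  ext I
  simp only [ReductionCode.decode, Finset.mem_toList, Set.Finite.mem_toFinset, Set.mem_image,
    Set.mem_ofPred_eq]
  constructor
  · rintro ⟨_, ⟨J, hJ, rfl⟩, rfl⟩
    rwa [hg]
  · intro hI
    exact ⟨_, ⟨I, hI, rfl⟩, hg I⟩

end Coverage

end Cookbook

namespace Cookbook

/-! ### Back-and-forth types of sets of instructions -/

section Types

/-! View a set of instructions `ρ` as a finite structure whose elements are the labels `j`. Since
the arity is at most `r`, only finitely many source structures can occur. Hence there are finitely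
many atomic statements about `n` labels and, for each depth, finitely many back-and-forth types.

The key claim: let `φ` define `Q`, and let `N` be large compared with `φ` and with the arities of
`τ`. If two cookbook reductions of arity at most `r` have the same type of depth `N`, then for every
`S` the structures in `ρ(S)` and `ρ'(S)` agree on `φ`. So whether `ρ` reduces `P` to `Q` depends
only on its type, and the algorithm computes this type and looks it up in a fixed finite table. The
problem `P` influences only the table, which merely has to exist; this is why `P` may be
undecidable.

For the claim, take `T` in `ρ(S)` and glue the targets of `ρ'` along the very embeddings that `T`
uses (`exists_produces_of_labelType_eq`). Consistency on overlaps concerns one tuple at a time,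
hence boundedly many labels, and transfers from `ρ` (`overlap_of_labelType_eq`). Then play the
Ehrenfeucht–Fraïssé game on the two targets: `(A, j)` is answered by `(A, j')` with the same `A`,
where `j'` is the answer in the game on labels (`exists_depth`). By (P5) the choice of the target
structure is irrelevant. -/

/-- The source structures of instructions of arity at most `r`. -/
abbrev SourceType (σ : Schema) (r : ℕ) : Type :=
  Σ k : Fin (r + 1), ∀ i : Fin σ.num, Set (Fin (σ.ar i) → Fin k)

/-- Atomic statements about a set of instructions and about `n` labels `j`: the labels `a` and `b`
are equal, `t` is in the support, `(univ, j)` is an element of the target structure that belongs to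
`t`, and a tuple is in a relation of the target structure that belongs to `t`. -/
abbrev Atom (σ τ : Schema) (r n : ℕ) : Type :=
  (Fin n × Fin n) ⊕ SourceType σ r ⊕ (SourceType σ r × Fin n) ⊕
    (Σ t : SourceType σ r, Σ i : Fin τ.num, Fin (τ.ar i) → Set (Fin t.1) × Fin n)

variable {σ τ : Schema} {r : ℕ}

/-- The truth of an atomic statement. -/
def Atom.Holds {n : ℕ} (ρ : Set (Instruction σ τ)) (xs : Fin n → ℕ) : Atom σ τ r n → Prop
  | .inl p => xs p.1 = xs p.2
  | .inr (.inl t) => ∃ S, ⟨t.1, t.2, S⟩ ∈ ρ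
  | .inr (.inr (.inl p)) => ∃ S, ⟨p.1.1, p.1.2, S⟩ ∈ ρ ∧ (Set.univ, xs p.2) ∈ S.univ
  | .inr (.inr (.inr p)) => ∃ S, ⟨p.1.1, p.1.2, S⟩ ∈ ρ ∧
      (fun l => ((p.2.2 l).1, xs (p.2.2 l).2)) ∈ S.rel p.2.1

/-- The possible back-and-forth types of depth `q` of `n` labels. -/
def LabelType (σ τ : Schema) (r : ℕ) : ℕ → ℕ → Type
  | 0, n => Set (Atom σ τ r n)
  | q + 1, n => Set (Atom σ τ r n) × Set (LabelType σ τ r q (n + 1))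

instance LabelType.instFinite (q n : ℕ) : Finite (LabelType σ τ r q n) := by
  induction q generalizing n with
  | zero => exact inferInstanceAs (Finite (Set (Atom σ τ r n)))
  | succ q ih =>
    have := ih (n + 1)
    exact inferInstanceAs (Finite (Set (Atom σ τ r n) × Set (LabelType σ τ r q (n + 1))))

/-- The labels `j` that occur in a set of instructions. -/
def labels (ρ : Set (Instruction σ τ)) : Set ℕ := {j | ∃ I ∈ ρ, ∃ A, (A, j) ∈ I.S.univ}

/-- The back-and-forth type of depth `q` of `n` labels. -/
def labelType (r : ℕ) (ρ : Set (Instruction σ τ)) :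
    ∀ (q : ℕ) {n : ℕ}, (Fin n → ℕ) → LabelType σ τ r q n
  | 0, _, xs => {a : Atom σ τ r _ | a.Holds ρ xs}
  | q + 1, _, xs => ({a : Atom σ τ r _ | a.Holds ρ xs},
      {v | ∃ j ∈ labels ρ, labelType r ρ q (Fin.snoc xs j) = v})

variable {ρ ρ' : Set (Instruction σ τ)} {q n : ℕ} {xs xs' : Fin n → ℕ}

theorem Atom.holds_iff_of_labelType_eq (h : labelType r ρ q xs = labelType r ρ' q xs')
    (a : Atom σ τ r n) : a.Holds ρ xs ↔ a.Holds ρ' xs' := by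
  cases q with
  | zero => exact Set.ext_iff.1 h a
  | succ q => exact Set.ext_iff.1 (congrArg Prod.fst h) a

theorem labelType_succ_eq_iff {w : Set (Atom σ τ r n)} {W : Set (LabelType σ τ r q (n + 1))} :
    labelType r ρ (q + 1) xs = (w, W) ↔ {a : Atom σ τ r n | a.Holds ρ xs} = w ∧
      {v | ∃ j ∈ labels ρ, labelType r ρ q (Fin.snoc xs j : Fin (n + 1) → ℕ) = v} = W :=
  Prod.ext_iff

theorem exists_labelType_snoc_eq (h : labelType r ρ (q + 1) xs = labelType r ρ' (q + 1) xs')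
    {j : ℕ} (hj : j ∈ labels ρ) :
    ∃ j' ∈ labels ρ', labelType r ρ q (Fin.snoc xs j : Fin (n + 1) → ℕ) =
      labelType r ρ' q (Fin.snoc xs' j' : Fin (n + 1) → ℕ) := by
  obtain ⟨j', hj', h'⟩ := (Set.ext_iff.1 (congrArg Prod.snd h) _).1 ⟨j, hj, rfl⟩
  exact ⟨j', hj', h'.symm⟩

/-- Play `m` rounds of the game on labels; each round costs one level of depth. -/
theorem exists_labelType_eq (m : ℕ)
    (h : labelType r ρ (q + m) (Fin.elim0 : Fin 0 → ℕ) = labelType r ρ' (q + m) Fin.elim0)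
    (ys : Fin m → ℕ) (hys : ∀ l, ys l ∈ labels ρ) :
    ∃ ys' : Fin m → ℕ, labelType r ρ q ys = labelType r ρ' q ys' := by
  induction m generalizing q with
  | zero => exact ⟨Fin.elim0, by rwa [Subsingleton.elim ys Fin.elim0]⟩
  | succ m ih =>
    -- The first `m` labels are answered with one level in reserve for the last one.
    obtain ⟨ys', h'⟩ := ih (q := q + 1) (by rwa [add_right_comm]) (Fin.init ys)
      fun l => hys l.castSucc
    obtain ⟨j', -, h''⟩ := exists_labelType_snoc_eq h' (hys (Fin.last m))
    rw [Fin.snoc_init_self] at h''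
    exact ⟨_, h''⟩

end Types

end Cookbook

namespace Cookbook

/-! ### Embeddings and types -/

section Embeddings

variable {σ τ : Schema} {S t u : FinStr σ}

theorem hat_injective {U V : Type} {π : U → V} (hπ : Function.Injective π) :
    Function.Injective (hat π) := by
  rintro ⟨A, j⟩ ⟨B, l⟩ h
  simp only [hat, Prod.mk.injEq] at h
  exact Prod.ext (hπ.image_injective h.1) h.2

theorem iUnion_hat {U V ι : Type} (π : U → V) (y : ι → Set U × ℕ) :
    ⋃ l, (hat π (y l)).1 = π '' ⋃ l, (y l).1 :=
  Set.image_iUnion.symm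

theorem exists_hat_eq {U V : Type} {π : U → V} {e : Set V × ℕ} (h : e.1 ⊆ Set.range π) :
    hat π (π ⁻¹' e.1, e.2) = e :=
  Prod.ext (Set.image_preimage_eq_of_subset h) rfl

theorem hatIsEmbedding_iff {U V : Type} {π : U → V} (hπ : Function.Injective π)
    {T : PairStr τ U} {T' : PairStr τ V} :
    HatIsEmbedding π T T' ↔ (∀ e ∈ T.univ, hat π e ∈ T'.univ) ∧
      ∀ i, ∀ x : Fin (τ.ar i) → Set U × ℕ, (∀ l, x l ∈ T.univ) →
        ((fun l => hat π (x l)) ∈ T'.rel i ↔ x ∈ T.rel i) := by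
  constructor
  · rintro ⟨F, hF⟩
    refine ⟨fun e he => hF ⟨e, he⟩ ▸ (F ⟨e, he⟩).2, fun i x hx => ?_⟩
    have := F.map_rel (.sym i : τ.Rel (τ.ar i)) fun l => ⟨x l, hx l⟩
    change (fun l => (F ⟨x l, hx l⟩).1) ∈ T'.rel i ↔ x ∈ T.rel i at this
    simpa only [hF] using this
  · rintro ⟨h1, h2⟩
    refine ⟨⟨⟨fun e => ⟨hat π e.1, h1 _ e.2⟩, fun e e' h => ?_⟩, fun f => Empty.elim f, ?_⟩,
      fun e => rfl⟩
    · exact Subtype.ext (hat_injective hπ (congrArg Subtype.val h))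
    · rintro _ ⟨i⟩ x
      exact h2 i (fun l => (x l).1) fun l => (x l).2

theorem HasType.image {A : Set t} (h : HasType t A u) (π : t ↪[σ.lang] S) :
    HasType S (π '' A) u := by
  obtain ⟨ν, rfl⟩ := h
  exact ⟨π.comp ν, by rw [← Set.range_comp]; rfl⟩

/-- An embedding whose range lies in the range of `π` factors through `π`. -/
theorem HasType.of_image {B : Set t} {π : t ↪[σ.lang] S} (h : HasType S (π '' B) u) :
    HasType t B u := by
  obtain ⟨ν, hν⟩ := h
  have hex : ∀ a, ∃ b, π b = ν a := fun a => by
    obtain ⟨b, -, hb⟩ : ν a ∈ π '' B := hν ▸ Set.mem_range_self a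
    exact ⟨b, hb⟩
  choose g hg using hex
  refine ⟨⟨⟨g, fun a b hab => ν.injective (by rw [← hg, ← hg, hab])⟩, fun f => Empty.elim f, ?_⟩,
    ?_⟩
  · intro n R x
    rw [← ν.map_rel, ← π.map_rel]
    exact iff_of_eq (congrArg _ (funext fun l => hg (x l)))
  · apply π.injective.image_injective
    rw [← hν, ← Set.range_comp]
    exact congrArg Set.range (funext hg)

theorem nonempty_equiv_of_range_eq (π : t ↪[σ.lang] S) (ν : u ↪[σ.lang] S)
    (h : Set.range ν = Set.range π) : Nonempty (t ≃[σ.lang] u) := by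
  have h' : HasType S (π '' Set.univ) u := ⟨ν, by rw [h, Set.image_univ]⟩
  obtain ⟨μ, hμ⟩ := h'.of_image
  let e : u ≃[σ.lang] t :=
    ⟨Equiv.ofBijective μ ⟨μ.injective, Set.range_eq_univ.1 hμ⟩, fun f => Empty.elim f,
      fun R x => μ.map_rel R x⟩
  exact ⟨e.symm⟩

end Embeddings

/-! ### Universe and relations of the produced structures -/

section Reductions

variable {σ τ : Schema} {ρ ρ' : Set (Instruction σ τ)} {S : FinStr σ}

namespace IsCookbookReduction

theorem eq_of_hasType (h : IsCookbookReduction ρ) {I J : Instruction σ τ} (hI : I ∈ ρ)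
    (hJ : J ∈ ρ) {A : Set S} (hIA : HasType S A I.t) (hJA : HasType S A J.t) : I = J := by
  obtain ⟨π, rfl⟩ := hIA
  obtain ⟨ν, hν⟩ := hJA
  exact h.distinct I hI J hJ (nonempty_equiv_of_range_eq π ν hν)

/-- Pairwise non-isomorphism applied to the identity. Thus the existential quantifier over targets
in `Atom.Holds` speaks of one particular target. -/
theorem target_unique (h : IsCookbookReduction ρ) {k : ℕ}
    {tr : ∀ i : Fin σ.num, Set (Fin (σ.ar i) → Fin k)} {U V : PairStr τ (Fin k)}
    (hU : ⟨k, tr, U⟩ ∈ ρ) (hV : ⟨k, tr, V⟩ ∈ ρ) : U = V := by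
  have : (⟨k, tr, U⟩ : Instruction σ τ) = ⟨k, tr, V⟩ :=
    h.distinct _ hU _ hV ⟨FirstOrder.Language.Equiv.refl σ.lang _⟩
  simpa using this

end IsCookbookReduction

/-- The elements of the structures in `ρ(S)`. -/
def targetUniv (ρ : Set (Instruction σ τ)) (S : FinStr σ) : Set (Set S × ℕ) :=
  {e | ∃ I ∈ ρ, HasType S e.1 I.t ∧ ((Set.univ : Set (Fin I.k)), e.2) ∈ I.S.univ}

theorem Produces.univ_eq {T : PairStr τ S} (hT : Produces ρ S T) : T.univ = targetUniv ρ S :=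
  Set.ext fun e => hT.s1 e.1 e.2

theorem IsCookbookReduction.finite_targetUniv (h : IsCookbookReduction ρ) (S : FinStr σ) :
    (targetUniv ρ S).Finite := by
  obtain ⟨T, hT⟩ := (h.p5 S).1
  exact hT.univ_eq ▸ T.finite

theorem snd_mem_labels_of_mem_targetUniv {e : Set S × ℕ} (he : e ∈ targetUniv ρ S) :
    e.2 ∈ labels ρ := by
  obtain ⟨I, hI, -, h⟩ := he
  exact ⟨I, hI, _, h⟩

/-- Membership depends only on the type of the set, so every embedding works, not just the one that
(S3) provides. For the full set this is uniqueness of the instruction; for proper subsets it is (P2)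
in one direction and (P4) in the other. -/
theorem IsCookbookReduction.hat_mem_targetUniv (h : IsCookbookReduction ρ) {I : Instruction σ τ}
    (hI : I ∈ ρ) (π : I.t ↪[σ.lang] S) (e : Set (Fin I.k) × ℕ) :
    hat π e ∈ targetUniv ρ S ↔ e ∈ I.S.univ := by
  obtain ⟨B, j⟩ := e
  by_cases hB : B = Set.univ
  · subst hB
    have hr : HasType S (π '' Set.univ) I.t := ⟨π, Set.image_univ.symm⟩
    constructor
    · rintro ⟨J, hJ, hJB, hj⟩
      obtain rfl := h.eq_of_hasType hI hJ hr hJB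
      exact hj
    · exact fun hj => ⟨I, hI, hr, hj⟩
  · constructor
    · rintro ⟨J, hJ, hJB, hj⟩
      obtain ⟨ν, hν, hF⟩ := h.p4 I hI J hJ B hB hJB.of_image
      have := ((hatIsEmbedding_iff ν.injective).1 hF).1 _ hj
      have hB' : hat ν ((Set.univ : Set (Fin J.k)), j) = (B, j) :=
        Prod.ext (by rw [← hν]; exact Set.image_univ) rfl
      change hat ν ((Set.univ : Set (Fin J.k)), j) ∈ I.S.univ at this
      rwa [hB'] at this
    · intro hj
      obtain ⟨J, hJ, hJB, hj'⟩ := h.p2 I hI B j hj hB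
      exact ⟨J, hJ, hJB.image π, hj'⟩

theorem Produces.hat_mem_rel (hT : Produces ρ S T) (h : IsCookbookReduction ρ)
    {I : Instruction σ τ} (hI : I ∈ ρ) {π : I.t ↪[σ.lang] S} (hπ : HatIsEmbedding π I.S T)
    {i : Fin τ.num} (y : Fin (τ.ar i) → Set (Fin I.k) × ℕ) :
    (fun l => hat π (y l)) ∈ T.rel i ↔ y ∈ I.S.rel i := by
  have hrel := ((hatIsEmbedding_iff π.injective).1 hπ).2 i y
  constructor
  · intro hy
    refine (hrel fun l => ?_).1 hy
    have := T.rel_mem i _ hy l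
    rwa [hT.univ_eq, h.hat_mem_targetUniv hI π] at this
  · exact fun hy => (hrel fun l => I.S.rel_mem i _ hy l).2 hy

end Reductions

/-! ### Transfer between reductions with equal label types -/

section Transfer

variable {σ τ : Schema} {r : ℕ} {ρ ρ' : Set (Instruction σ τ)} {q n : ℕ} {xs xs' : Fin n → ℕ}
  {k : ℕ} {tr : ∀ i : Fin σ.num, Set (Fin (σ.ar i) → Fin k)} {U U' : PairStr τ (Fin k)}
  {S : FinStr σ}

theorem exists_mem_of_labelType_eq (h : labelType r ρ q xs = labelType r ρ' q xs') (hk : k ≤ r)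
    (hU : ⟨k, tr, U⟩ ∈ ρ) : ∃ V, ⟨k, tr, V⟩ ∈ ρ' :=
  (Atom.holds_iff_of_labelType_eq h
    (.inr (.inl ⟨⟨k, Nat.lt_succ_of_le hk⟩, tr⟩))).1 ⟨U, hU⟩

theorem inSupport_of_labelType_eq (h : labelType r ρ q xs = labelType r ρ' q xs')
    (hr : ArityLE ρ r) {A : Set S} (hA : InSupport ρ S A) : InSupport ρ' S A := by
  obtain ⟨⟨k, tr, U⟩, hI, hA⟩ := hA
  obtain ⟨V, hV⟩ := exists_mem_of_labelType_eq h (hr _ hI) hI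
  exact ⟨_, hV, hA⟩

theorem inSupport_iff_of_labelType_eq (h : labelType r ρ q xs = labelType r ρ' q xs')
    (hr : ArityLE ρ r) (hr' : ArityLE ρ' r) {A : Set S} : InSupport ρ S A ↔ InSupport ρ' S A :=
  ⟨inSupport_of_labelType_eq h hr, inSupport_of_labelType_eq h.symm hr'⟩

theorem mem_targetUniv_of_labelType_eq (h : labelType r ρ q xs = labelType r ρ' q xs')
    (hr : ArityLE ρ r) {A : Set S} {a : Fin n} (hA : (A, xs a) ∈ targetUniv ρ S) :
    (A, xs' a) ∈ targetUniv ρ' S := by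
  obtain ⟨⟨k, tr, U⟩, hI, hA, hj⟩ := hA
  obtain ⟨V, hV, hj'⟩ := (Atom.holds_iff_of_labelType_eq h
    (.inr (.inr (.inl (⟨⟨k, Nat.lt_succ_of_le (hr _ hI)⟩, tr⟩, a))))).1 ⟨U, hI, hj⟩
  exact ⟨_, hV, hA, hj'⟩

theorem mem_rel_of_labelType_eq (hρ' : IsCookbookReduction ρ')
    (h : labelType r ρ q xs = labelType r ρ' q xs') (hk : k ≤ r)
    (hU : ⟨k, tr, U⟩ ∈ ρ) (hU' : ⟨k, tr, U'⟩ ∈ ρ') {i : Fin τ.num}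
    {y : Fin (τ.ar i) → Set (Fin k) × Fin n}
    (hy : (fun l => ((y l).1, xs (y l).2)) ∈ U.rel i) :
    (fun l => ((y l).1, xs' (y l).2)) ∈ U'.rel i := by
  obtain ⟨V, hV, hj'⟩ := (Atom.holds_iff_of_labelType_eq h
    (.inr (.inr (.inr ⟨⟨⟨k, Nat.lt_succ_of_le hk⟩, tr⟩, i, y⟩)))).1 ⟨U, hU, hy⟩
  obtain rfl := hρ'.target_unique hU' hV
  exact hj'

theorem mem_rel_iff_of_labelType_eq (hρ : IsCookbookReduction ρ) (hρ' : IsCookbookReduction ρ')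
    (h : labelType r ρ q xs = labelType r ρ' q xs') (hk : k ≤ r)
    (hU : ⟨k, tr, U⟩ ∈ ρ) (hU' : ⟨k, tr, U'⟩ ∈ ρ') {i : Fin τ.num}
    (y : Fin (τ.ar i) → Set (Fin k) × Fin n) :
    (fun l => ((y l).1, xs (y l).2)) ∈ U.rel i ↔ (fun l => ((y l).1, xs' (y l).2)) ∈ U'.rel i :=
  ⟨mem_rel_of_labelType_eq hρ' h hk hU hU', mem_rel_of_labelType_eq hρ h.symm hk hU' hU⟩

/-- Overlaps of the images of two target structures are consistent for `ρ'` if they are for `ρ`. -/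
theorem overlap_of_labelType_eq (hρ : IsCookbookReduction ρ) (hρ' : IsCookbookReduction ρ')
    {N : ℕ} (h : labelType r ρ N (Fin.elim0 : Fin 0 → ℕ) = labelType r ρ' N Fin.elim0)
    (hr' : ArityLE ρ' r) {i : Fin τ.num} (hN : τ.ar i ≤ N)
    {k₁ : ℕ} {tr₁ : ∀ i : Fin σ.num, Set (Fin (σ.ar i) → Fin k₁)} {U₁ U₁' : PairStr τ (Fin k₁)}
    (hU : ⟨k, tr, U⟩ ∈ ρ) (hU' : ⟨k, tr, U'⟩ ∈ ρ')
    (hU₁ : ⟨k₁, tr₁, U₁⟩ ∈ ρ) (hU₁' : ⟨k₁, tr₁, U₁'⟩ ∈ ρ')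
    {π : Fin k → S} {π₁ : Fin k₁ → S}
    (H : ∀ (y : Fin (τ.ar i) → Set (Fin k) × ℕ) (z : Fin (τ.ar i) → Set (Fin k₁) × ℕ),
      (∀ l, hat π (y l) = hat π₁ (z l)) → (y ∈ U.rel i ↔ z ∈ U₁.rel i))
    (y : Fin (τ.ar i) → Set (Fin k) × ℕ) (z : Fin (τ.ar i) → Set (Fin k₁) × ℕ)
    (hyz : ∀ l, hat π (y l) = hat π₁ (z l)) : y ∈ U'.rel i ↔ z ∈ U₁'.rel i := by
  have hsnd : ∀ l, (y l).2 = (z l).2 := fun l => congrArg Prod.snd (hyz l)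
  by_cases hlab : ∀ l, (y l).2 ∈ labels ρ'
  · obtain ⟨p, rfl⟩ := Nat.exists_eq_add_of_le' hN
    -- The tuples `y` and `z` have the same labels, so one choice of answers `js` moves both of them
    -- to `ρ`, where consistency is known.
    obtain ⟨js, hjs⟩ := exists_labelType_eq (τ.ar i) h.symm (fun l => (y l).2) hlab
    have h1 := mem_rel_iff_of_labelType_eq hρ hρ' hjs.symm (hr' _ hU') hU hU'
      fun l => ((y l).1, l)
    have h2 := mem_rel_iff_of_labelType_eq hρ hρ' hjs.symm (hr' _ hU₁') hU₁ hU₁'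
      fun l => ((z l).1, l)
    simp only [hsnd] at h2
    rw [← h1.trans Iff.rfl, ← h2.trans Iff.rfl]
    exact H _ _ fun l => Prod.ext (congrArg Prod.fst (hyz l) :) rfl
  -- A tuple with a label foreign to `ρ'` is in neither relation.
  · refine iff_of_false (fun hy => hlab fun l => ?_) (fun hz => hlab fun l => ?_)
    · exact ⟨_, hU', _, U'.rel_mem i _ hy l⟩
    · exact hsnd l ▸ ⟨_, hU₁', _, U₁'.rel_mem i _ hz l⟩

/-- Sets of instructions with the same type produce similar target structures. -/
theorem exists_produces_of_labelType_eq (hρ : IsCookbookReduction ρ)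
    (hρ' : IsCookbookReduction ρ') (hr : ArityLE ρ r) (hr' : ArityLE ρ' r) {N : ℕ}
    (h : labelType r ρ N (Fin.elim0 : Fin 0 → ℕ) = labelType r ρ' N Fin.elim0)
    (hN : ∀ i, τ.ar i ≤ N) {T : PairStr τ S} (hT : Produces ρ S T) :
    ∃ T' : PairStr τ S, Produces ρ' S T' ∧
      ∀ {q n : ℕ} {xs xs' : Fin n → ℕ}, labelType r ρ q xs = labelType r ρ' q xs' →
        ∀ (i : Fin τ.num) (x : Fin (τ.ar i) → Set S × Fin n),
          (fun l => ((x l).1, xs (x l).2)) ∈ T.rel i ↔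
            (fun l => ((x l).1, xs' (x l).2)) ∈ T'.rel i := by
  -- One embedding per supported set `A`, taken from (S3) for `T`, serves both reductions, as the
  -- two instructions share their source structure.
  have key : ∀ A : Set S, InSupport ρ S A → ∃ (k : ℕ)
      (tr : ∀ i : Fin σ.num, Set (Fin (σ.ar i) → Fin k)) (U U' : PairStr τ (Fin k)),
      ⟨k, tr, U⟩ ∈ ρ ∧ ⟨k, tr, U'⟩ ∈ ρ' ∧ ∃ f : Fin k → S,
        (∃ π : (⟨k, tr, U'⟩ : Instruction σ τ).t ↪[σ.lang] S, ∀ a, π a = f a) ∧ Set.range f = A ∧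
        (∀ (i : Fin τ.num) (y : Fin (τ.ar i) → Set (Fin k) × ℕ),
          (fun l => hat f (y l)) ∈ T.rel i ↔ y ∈ U.rel i) ∧
        ∀ e : Set (Fin k) × ℕ, hat f e ∈ targetUniv ρ' S ↔ e ∈ U'.univ := by
    rintro A ⟨⟨k, tr, U⟩, hI, hA⟩
    obtain ⟨V, hV⟩ := exists_mem_of_labelType_eq h (hr _ hI) hI
    obtain ⟨π, hπ, hF⟩ := hT.s3 _ hI A hA
    exact ⟨k, tr, U, V, hI, hV, π, ⟨π, fun _ => rfl⟩, hπ, fun i y => hT.hat_mem_rel hρ hI hF y,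
      fun e => hρ'.hat_mem_targetUniv hV π e⟩
  choose k tr U U' hU hU' π hemb hπ hrel huniv using key
  have hinj : ∀ A hA, Function.Injective (π A hA) := fun A hA => by
    obtain ⟨ν, hν⟩ := hemb A hA
    exact fun a b hab => ν.injective ((hν a).trans (hab.trans (hν b).symm))
  have htype : ∀ A hA, HasType S A (⟨k A hA, tr A hA, U' A hA⟩ : Instruction σ τ).t :=
    fun A hA => by
      obtain ⟨ν, hν⟩ := hemb A hA
      exact ⟨ν, (congrArg Set.range (funext hν)).trans (hπ A hA)⟩
  have hsupp : ∀ {A : Set S}, InSupport ρ S A ↔ InSupport ρ' S A :=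
    inSupport_iff_of_labelType_eq h hr hr'
  let T' : PairStr τ S :=
    { univ := targetUniv ρ' S
      finite := hρ'.finite_targetUniv S
      rel := fun i => {x | ∃ hA : InSupport ρ S (⋃ l, (x l).1), ∃ y ∈ (U' _ hA).rel i,
        (fun l => hat (π _ hA) (y l)) = x}
      rel_mem := by
        rintro i _ ⟨hA, y, hy, hx⟩ l
        rw [← congrFun hx l, huniv]
        exact (U' _ hA).rel_mem i y hy l }
  -- The relations of `T'` are defined through the embedding for the union of the tuple's sets. Here
  -- they are compared with the embedding for an arbitrary supported `A`, which may be larger.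
  have hrel' : ∀ (A : Set S) (hA : InSupport ρ S A) {i : Fin τ.num}
      (y : Fin (τ.ar i) → Set (Fin (k A hA)) × ℕ),
      (fun l => hat (π A hA) (y l)) ∈ T'.rel i ↔ y ∈ (U' A hA).rel i := by
    intro A hA i y
    have hov := fun (B : Set S) (hB : InSupport ρ S B) =>
      overlap_of_labelType_eq hρ hρ' h hr' (hN i) (hU A hA) (hU' A hA) (hU B hB) (hU' B hB)
        (π := π A hA) (π₁ := π B hB) (fun y z hyz => by
          rw [← hrel A hA, ← hrel B hB, funext hyz]) y
    constructor
    · rintro ⟨hB, z, hz, hx⟩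
      exact (hov _ hB z fun l => (congrFun hx l).symm).2 hz
    · intro hy
      -- (P3) puts the type of the union in the support when the union is a proper subset of `A`.
      have hB : InSupport ρ S (⋃ l, (hat (π A hA) (y l)).1) := by
        rw [iUnion_hat]
        by_cases hun : ⋃ l, (y l).1 = Set.univ
        · rw [hun, Set.image_univ, hπ]
          exact hA
        · obtain ⟨J, hJ, hJy⟩ := hρ'.p3 _ (hU' A hA) i y hy hun
          obtain ⟨ν, hν⟩ := hemb A hA
          have hν' : (ν : Fin (k A hA) → S) = π A hA := funext hν
          have := hJy.image ν
          exact hsupp.2 ⟨J, hJ, hν' ▸ this⟩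
      have hz : ∀ l, hat (π _ hB) (π _ hB ⁻¹' (hat (π A hA) (y l)).1, (y l).2) =
          hat (π A hA) (y l) := fun l =>
        exists_hat_eq (e := hat (π A hA) (y l)) (by
          rw [hπ]; exact Set.subset_iUnion (fun l => (hat (π A hA) (y l)).1) l)
      exact ⟨hB, _, (hov _ hB _ fun l => (hz l).symm).1 hy, funext hz⟩
  refine ⟨T', ⟨fun A j => Iff.rfl, ?_, ?_⟩, ?_⟩
  · rintro i x ⟨hA, -⟩
    exact hsupp.1 hA
  · intro I hI A hIA
    have hA : InSupport ρ S A := hsupp.2 ⟨I, hI, hIA⟩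
    obtain rfl := hρ'.eq_of_hasType (hU' A hA) hI (htype A hA) hIA
    obtain ⟨ν, hν⟩ := hemb A hA
    have hν' : (ν : Fin (k A hA) → S) = π A hA := funext hν
    have := (hatIsEmbedding_iff (hinj A hA)).2
      ⟨fun e he => (huniv A hA e).2 he, fun i y _ => hrel' A hA y⟩
    exact ⟨ν, (congrArg Set.range hν').trans (hπ A hA), hν' ▸ this⟩
  · intro q n xs xs' hxs i x
    by_cases hA : InSupport ρ S (⋃ l, (x l).1)
    · have hz : ∀ (js : Fin n → ℕ) l,
          hat (π _ hA) (π _ hA ⁻¹' (x l).1, js (x l).2) = ((x l).1, js (x l).2) := fun js l =>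
        exists_hat_eq (e := ((x l).1, js (x l).2)) (by
          rw [hπ]; exact Set.subset_iUnion (fun l => (x l).1) l)
      rw [← funext (hz xs), ← funext (hz xs'), hrel, hrel']
      exact mem_rel_iff_of_labelType_eq hρ hρ' hxs (hr _ (hU _ hA)) (hU _ hA) (hU' _ hA)
        fun l => (π _ hA ⁻¹' (x l).1, (x l).2)
    · exact iff_of_false (fun hx => hA (hT.s2 i _ hx)) fun hx => hA hx.1

end Transfer

end Cookbook

namespace Cookbook

/-! ### The type of a coded set of instructions is computable -/

section Primrec

variable {α β ι : Type} [Primcodable α] [Primcodable β]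

theorem _root_.PrimrecPred.true : PrimrecPred fun _ : α => True :=
  (Primrec.eq.comp (Primrec.const 0) (Primrec.const 0)).of_eq fun _ => by simp

/-- The case split is classical: `b` need not be decidable. Undecidable information about `P` enters
the algorithm through this lemma. -/
theorem _root_.PrimrecPred.constProp (b : Prop) : PrimrecPred fun _ : α => b := by
  by_cases hb : b
  · simpa only [hb] using PrimrecPred.true
  · simpa only [hb, not_true_eq_false] using (PrimrecPred.true (α := α)).not

theorem _root_.PrimrecPred.iff {p q : α → Prop} (hp : PrimrecPred p) (hq : PrimrecPred q) :
    PrimrecPred fun a => p a ↔ q a :=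
  ((hp.and hq).or (hp.not.and hq.not)).of_eq fun _ => by tauto

theorem _root_.PrimrecPred.forall_finite [Finite ι] {p : ι → α → Prop}
    (hp : ∀ i, PrimrecPred (p i)) : PrimrecPred fun a => ∀ i, p i a := by
  have := Fintype.ofFinite ι
  have h : ∀ L : List ι, PrimrecPred fun a => ∀ i ∈ L, p i a := fun L => by
    induction L with
    | nil => simpa using PrimrecPred.true
    | cons i L ih => simpa using (hp i).and ih
  exact (h Finset.univ.toList).of_eq fun a => by simp

theorem _root_.PrimrecPred.exists_finite [Finite ι] {p : ι → α → Prop}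
    (hp : ∀ i, PrimrecPred (p i)) : PrimrecPred fun a => ∃ i, p i a :=
  (PrimrecPred.forall_finite fun i => (hp i).not).not.of_eq fun a => by simp

theorem _root_.PrimrecPred.exists_mem {f : α → List β} {p : α × β → Prop} (hf : Primrec f)
    (hp : PrimrecPred p) : PrimrecPred fun a => ∃ b ∈ f a, p (a, b) :=
  PrimrecRel.comp (R := fun (L : List β) a => ∃ b ∈ L, p (a, b))
    (PrimrecRel.exists_mem_list (R := fun b a => p (a, b))
      (hp.comp (Primrec.snd.pair Primrec.fst))) hf Primrec.id

theorem _root_.PrimrecPred.mem {f : α → List β} {g : α → β} (hf : Primrec f) (hg : Primrec g) :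
    PrimrecPred fun a => g a ∈ f a :=
  (PrimrecPred.exists_mem hf (p := fun p => p.2 = g p.1)
    (Primrec.eq.comp Primrec.snd (hg.comp Primrec.fst))).of_eq fun a => by simp

end Primrec

/-! ### Deciding label types from codes -/

section Decode

variable {σ τ : Schema} {r : ℕ} {α : Type} [Primcodable α]

theorem PairCode.primrecPred_decode_eq (k : ℕ) (A : Set (Fin k)) {e : α → PairCode} {j : α → ℕ}
    (he : Primrec e) (hj : Primrec j) :
    PrimrecPred fun a => PairCode.decode k (e a) = (A, j a) := by
  refine ((PrimrecPred.forall_finite fun x : Fin k =>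
    (PrimrecPred.mem (Primrec.fst.comp he) (Primrec.const (x : ℕ))).iff
      (PrimrecPred.constProp (x ∈ A))).and
      (Primrec.eq.comp (Primrec.snd.comp he) hj)).of_eq fun a => ?_
  simp only [PairCode.decode, Prod.mk.injEq, Set.ext_iff, Set.mem_ofPred_eq]

/-- The source structure of the coded instruction is the given one. -/
def InstructionCode.HasSource (k : ℕ) (tr : ∀ i : Fin σ.num, Set (Fin (σ.ar i) → Fin k))
    (d : InstructionCode) : Prop :=
  d.1 = k ∧ ∀ (i : Fin σ.num) (x : Fin (σ.ar i) → Fin k),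
    ((i : ℕ), List.ofFn fun l => (x l : ℕ)) ∈ d.2.1 ↔ x ∈ tr i

theorem InstructionCode.primrecPred_hasSource (k : ℕ)
    (tr : ∀ i : Fin σ.num, Set (Fin (σ.ar i) → Fin k)) {d : α → InstructionCode}
    (hd : Primrec d) : PrimrecPred fun a => InstructionCode.HasSource k tr (d a) :=
  (Primrec.eq.comp (Primrec.fst.comp hd) (Primrec.const k)).and <|
    PrimrecPred.forall_finite fun i => PrimrecPred.forall_finite fun x =>
      (PrimrecPred.mem (Primrec.fst.comp (Primrec.snd.comp hd)) (Primrec.const _)).iff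
        (PrimrecPred.constProp (x ∈ tr i))

/-- The target structure of a coded instruction, if the source structure has universe `[k]`. -/
def InstructionCode.target (τ : Schema) (k : ℕ) (d : InstructionCode) : PairStr τ (Fin k) :=
  (InstructionCode.decode ⟨0, Fin.elim0⟩ τ (k, d.2)).S

/-- Decoding the target over a prescribed `k` avoids a cast along `d.1 = k`. -/
theorem InstructionCode.decode_eq_iff (k : ℕ)
    (tr : ∀ i : Fin σ.num, Set (Fin (σ.ar i) → Fin k)) (V : PairStr τ (Fin k))
    (d : InstructionCode) : InstructionCode.decode σ τ d = ⟨k, tr, V⟩ ↔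
      InstructionCode.HasSource k tr d ∧ InstructionCode.target τ k d = V := by
  obtain ⟨k', f, u, R⟩ := d
  by_cases hk : k' = k
  · subst hk
    simp [InstructionCode.decode, InstructionCode.HasSource, InstructionCode.target,
      funext_iff, Set.ext_iff]
  · simp [InstructionCode.decode, InstructionCode.HasSource, hk]

theorem ReductionCode.exists_mem_decode_iff (k : ℕ)
    (tr : ∀ i : Fin σ.num, Set (Fin (σ.ar i) → Fin k)) (p : PairStr τ (Fin k) → Prop)
    (c : ReductionCode) : (∃ V, ⟨k, tr, V⟩ ∈ ReductionCode.decode σ τ c ∧ p V) ↔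
      ∃ d ∈ c, InstructionCode.HasSource k tr d ∧ p (InstructionCode.target τ k d) := by
  simp only [ReductionCode.decode, Set.mem_ofPred_eq, InstructionCode.decode_eq_iff]
  constructor
  · rintro ⟨_, ⟨d, hd, hs, rfl⟩, hp⟩
    exact ⟨d, hd, hs, hp⟩
  · rintro ⟨d, hd, hs, hp⟩
    exact ⟨_, ⟨d, hd, hs, rfl⟩, hp⟩

theorem InstructionCode.primrecPred_mem_univ (τ : Schema) (k : ℕ) (A : Set (Fin k))
    {d : α → InstructionCode} {j : α → ℕ} (hd : Primrec d) (hj : Primrec j) :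
    PrimrecPred fun a => (A, j a) ∈ (InstructionCode.target τ k (d a)).univ :=
  PrimrecPred.exists_mem (f := fun a => (d a).2.2.1)
    (p := fun p : α × PairCode => PairCode.decode k p.2 = (A, j p.1))
    (Primrec.fst.comp (Primrec.snd.comp (Primrec.snd.comp hd)))
    (PairCode.primrecPred_decode_eq k A Primrec.snd (hj.comp Primrec.fst))

/-- Turns list equality into finitely many primitive recursive tests. The default `([], 0)` is never
read once the length is right. -/
theorem PairCode.map_decode_eq_ofFn_iff {k m : ℕ} (ds : List PairCode)
    (x : Fin m → Set (Fin k) × ℕ) : ds.map (PairCode.decode k) = List.ofFn x ↔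
      ds.length = m ∧ ∀ l : Fin m, PairCode.decode k (ds.getD l ([], 0)) = x l := by
  constructor
  · intro h
    have hl : ds.length = m := by simpa using congrArg List.length h
    refine ⟨hl, fun l => ?_⟩
    have h' := congrArg (fun L => L[(l : ℕ)]?) h
    have hlt : (l : ℕ) < ds.length := hl ▸ l.2
    simpa [hlt] using h'
  · rintro ⟨rfl, h⟩
    refine List.ext_getElem (by simp) fun l h1 h2 => ?_
    have hlt : l < ds.length := by simpa using h1
    simpa [hlt] using h ⟨l, hlt⟩

theorem InstructionCode.primrecPred_mem_rel (k : ℕ) (i : Fin τ.num)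
    (A : Fin (τ.ar i) → Set (Fin k)) {d : α → InstructionCode} {j : Fin (τ.ar i) → α → ℕ}
    (hd : Primrec d) (hj : ∀ l, Primrec (j l)) :
    PrimrecPred fun a => (fun l => (A l, j l a)) ∈ (InstructionCode.target τ k (d a)).rel i := by
  refine ((PrimrecPred.forall_finite fun l =>
    InstructionCode.primrecPred_mem_univ τ k (A l) hd (hj l)).and
    (PrimrecPred.exists_mem (f := fun a => (d a).2.2.2)
      (p := fun p : α × (ℕ × List PairCode) => p.2.1 = i ∧ p.2.2.length = τ.ar i ∧
        ∀ l : Fin (τ.ar i), PairCode.decode k (p.2.2.getD l ([], 0)) = (A l, j l p.1))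
      (Primrec.snd.comp (Primrec.snd.comp (Primrec.snd.comp hd))) ?_)).of_eq fun a => ?_
  · refine (Primrec.eq.comp (Primrec.fst.comp Primrec.snd) (Primrec.const _)).and
      ((Primrec.eq.comp (Primrec.list_length.comp (Primrec.snd.comp Primrec.snd))
        (Primrec.const _)).and (PrimrecPred.forall_finite fun l =>
          PairCode.primrecPred_decode_eq k (A l) ?_ ((hj l).comp Primrec.fst)))
    exact (Primrec.list_getD ([], 0)).comp (Primrec.snd.comp Primrec.snd) (Primrec.const _)
  · refine and_congr Iff.rfl ?_
    simp only [← PairCode.map_decode_eq_ofFn_iff]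
    constructor
    · rintro ⟨⟨_, ds⟩, hm, rfl, h⟩
      exact ⟨ds, hm, h⟩
    · rintro ⟨ds, hm, h⟩
      exact ⟨(i, ds), hm, rfl, h⟩

theorem Atom.primrecPred_holds {n : ℕ} (b : Atom σ τ r n) {c : α → ReductionCode}
    {xs : Fin n → α → ℕ} (hc : Primrec c) (hxs : ∀ l, Primrec (xs l)) :
    PrimrecPred fun a => b.Holds (ReductionCode.decode σ τ (c a)) fun l => xs l a := by
  rcases b with ⟨i, j⟩ | t | ⟨t, l⟩ | ⟨t, i, y⟩
  · exact Primrec.eq.comp (hxs i) (hxs j)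
  · refine (PrimrecPred.exists_mem hc (p := fun p => InstructionCode.HasSource t.1 t.2 p.2)
      (InstructionCode.primrecPred_hasSource _ _ Primrec.snd)).of_eq fun a => ?_
    have := ReductionCode.exists_mem_decode_iff (τ := τ) t.1 t.2 (fun _ => True) (c a)
    simp only [and_true] at this
    exact this.symm
  · exact (PrimrecPred.exists_mem hc
      (p := fun p => InstructionCode.HasSource t.1 t.2 p.2 ∧
        (Set.univ, xs l p.1) ∈ (InstructionCode.target τ t.1 p.2).univ)
      ((InstructionCode.primrecPred_hasSource _ _ Primrec.snd).and
        (InstructionCode.primrecPred_mem_univ τ _ _ Primrec.snd ((hxs l).comp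
          Primrec.fst)))).of_eq fun a =>
      (ReductionCode.exists_mem_decode_iff t.1 t.2 (fun V => (Set.univ, xs l a) ∈ V.univ)
        (c a)).symm
  · exact (PrimrecPred.exists_mem hc
      (p := fun p => InstructionCode.HasSource t.1 t.2 p.2 ∧
        (fun l => ((y l).1, xs (y l).2 p.1)) ∈ (InstructionCode.target τ t.1 p.2).rel i)
      ((InstructionCode.primrecPred_hasSource _ _ Primrec.snd).and
        (InstructionCode.primrecPred_mem_rel _ i (fun l => (y l).1) Primrec.snd
          fun l => (hxs (y l).2).comp Primrec.fst))).of_eq fun a =>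
      (ReductionCode.exists_mem_decode_iff t.1 t.2
        (fun V => (fun l => ((y l).1, xs (y l).2 a)) ∈ V.rel i) (c a)).symm

theorem Atom.primrecPred_setOf_holds_eq {n : ℕ} {c : α → ReductionCode} {xs : Fin n → α → ℕ}
    (hc : Primrec c) (hxs : ∀ l, Primrec (xs l)) (w : Set (Atom σ τ r n)) : PrimrecPred fun a =>
      {b : Atom σ τ r n | b.Holds (ReductionCode.decode σ τ (c a)) fun l => xs l a} = w :=
  (PrimrecPred.forall_finite fun b : Atom σ τ r n =>
    (b.primrecPred_holds hc hxs).iff (PrimrecPred.constProp (b ∈ w))).of_eq fun _ =>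
      Set.ext_iff.symm

/-- Decoding keeps the label of every listed pair, so a move in the game on labels is a bounded
search through the code. -/
theorem exists_mem_labels_decode_iff (c : ReductionCode) (p : ℕ → Prop) :
    (∃ j ∈ labels (ReductionCode.decode σ τ c), p j) ↔ ∃ d ∈ c, ∃ e ∈ d.2.2.1, p e.2 := by
  constructor
  · rintro ⟨j, ⟨_, ⟨d, hd, rfl⟩, A, e, he, h⟩, hp⟩
    obtain rfl : e.2 = j := congrArg Prod.snd h
    exact ⟨d, hd, e, he, hp⟩
  · rintro ⟨d, hd, e, he, hp⟩
    exact ⟨e.2, ⟨_, ⟨d, hd, rfl⟩, _, e, he, rfl⟩, hp⟩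

/-- The parameter type `α` varies in the induction: a chosen label becomes a further input, carried
by the instruction code and pair code in which it was found. -/
theorem primrecPred_labelType_eq (q : ℕ) {n : ℕ} {α : Type} [Primcodable α]
    {c : α → ReductionCode} {xs : Fin n → α → ℕ} (hc : Primrec c) (hxs : ∀ l, Primrec (xs l))
    (v : LabelType σ τ r q n) :
    PrimrecPred fun a => labelType r (ReductionCode.decode σ τ (c a)) q (fun l => xs l a) = v := by
  induction q generalizing n α with
  | zero => exact Atom.primrecPred_setOf_holds_eq hc hxs v
  | succ q ih =>
    obtain ⟨w, W⟩ := v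
    have hW : ∀ u : LabelType σ τ r q (n + 1), PrimrecPred fun a =>
        (∃ d ∈ c a, ∃ e ∈ d.2.2.1, labelType r (ReductionCode.decode σ τ (c a)) q
          (Fin.snoc (fun l => xs l a) e.2 : Fin (n + 1) → ℕ) = u) ↔ u ∈ W := fun u => by
      refine (PrimrecPred.exists_mem (p := fun p : α × InstructionCode =>
        ∃ e ∈ p.2.2.2.1, labelType r (ReductionCode.decode σ τ (c p.1)) q
          (Fin.snoc (fun l => xs l p.1) e.2 : Fin (n + 1) → ℕ) = u) hc
        (PrimrecPred.exists_mem (f := fun p : α × InstructionCode => p.2.2.2.1)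
          (p := fun p : (α × InstructionCode) × PairCode =>
            labelType r (ReductionCode.decode σ τ (c p.1.1)) q
              (Fin.snoc (fun l => xs l p.1.1) p.2.2 : Fin (n + 1) → ℕ) = u)
          (Primrec.fst.comp (Primrec.snd.comp (Primrec.snd.comp Primrec.snd))) ?_)).iff
            (PrimrecPred.constProp _)
      have hfst : Primrec fun p : (α × InstructionCode) × PairCode => p.1.1 :=
        Primrec.fst.comp Primrec.fst
      refine ih (α := (α × InstructionCode) × PairCode) (c := fun p => c p.1.1)
        (xs := fun l p => (Fin.snoc (fun l => xs l p.1.1) p.2.2 : Fin (n + 1) → ℕ) l)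
        (hc.comp hfst) (fun l => ?_) u
      induction l using Fin.lastCases with
      | last => simpa only [Fin.snoc_last] using Primrec.snd.comp Primrec.snd
      | cast l => simpa only [Fin.snoc_castSucc] using (hxs l).comp hfst
    refine ((Atom.primrecPred_setOf_holds_eq hc hxs w).and (PrimrecPred.forall_finite hW)).of_eq fun a => ?_
    have hlab := fun u => exists_mem_labels_decode_iff (σ := σ) (τ := τ) (c a) fun j =>
      labelType r (ReductionCode.decode σ τ (c a)) q
        (Fin.snoc (fun l => xs l a) j : Fin (n + 1) → ℕ) = u
    refine (and_congr Iff.rfl ?_).trans labelType_succ_eq_iff.symm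
    exact (forall_congr' fun u => iff_congr (hlab u).symm Iff.rfl).trans Set.ext_iff.symm

end Decode

end Cookbook

namespace Cookbook

/-! ### First-order equivalence of target structures -/

section Transfer

variable {σ τ : Schema} {r : ℕ} {ρ ρ' : Set (Instruction σ τ)} {S : FinStr σ}

/-- A formula does not distinguish tuples in two similar target structures of the same source
structure if their label types agree up to a depth that only depends on the formula. -/
theorem exists_depth {n : ℕ} (φ : τ.lang.BoundedFormula Empty n) :
    ∃ N, ∀ q, N ≤ q → ∀ {r : ℕ} {ρ ρ' : Set (Instruction σ τ)} {S : FinStr σ} {T T' : PairStr τ S},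
      ArityLE ρ r → ArityLE ρ' r → T.univ = targetUniv ρ S → T'.univ = targetUniv ρ' S →
      (∀ {q n : ℕ} {xs xs' : Fin n → ℕ}, labelType r ρ q xs = labelType r ρ' q xs' →
        ∀ (i : Fin τ.num) (x : Fin (τ.ar i) → Set S × Fin n),
          (fun l => ((x l).1, xs (x l).2)) ∈ T.rel i ↔
            (fun l => ((x l).1, xs' (x l).2)) ∈ T'.rel i) →
      ∀ (v : Empty → T.toFinStr) (v' : Empty → T'.toFinStr)
        (x : Fin n → T.toFinStr) (x' : Fin n → T'.toFinStr), (∀ l, (x l).1.1 = (x' l).1.1) →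
        labelType r ρ q (fun l => (x l).1.2) = labelType r ρ' q (fun l => (x' l).1.2) →
        (φ.Realize v x ↔ φ.Realize v' x') := by
  have hvar : ∀ {n : ℕ} (t : τ.lang.Term (Empty ⊕ Fin n)), ∃ l : Fin n, t = .var (.inr l) := by
    rintro n ((e | l) | ⟨f, -⟩)
    · exact e.elim
    · exact ⟨l, rfl⟩
    · exact Empty.elim f
  induction φ with
  | falsum => exact ⟨0, by intros; exact Iff.rfl⟩
  | equal t₁ t₂ =>
    refine ⟨0, fun q _ r ρ ρ' S T T' hr hr' hT hT' hrel v v' x x' hx hty => ?_⟩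
    obtain ⟨a, rfl⟩ := hvar t₁
    obtain ⟨b, rfl⟩ := hvar t₂
    have := Atom.holds_iff_of_labelType_eq hty (.inl (a, b))
    change x a = x b ↔ x' a = x' b
    have hext : ∀ {U : PairStr τ S} (e e' : U.toFinStr),
        e = e' ↔ e.1.1 = e'.1.1 ∧ e.1.2 = e'.1.2 := fun _ _ => Subtype.ext_iff.trans Prod.ext_iff
    rw [hext, hext, hx, hx]
    exact and_congr Iff.rfl this
  | @rel n l R ts =>
    refine ⟨0, fun q _ r ρ ρ' S T T' hr hr' hT hT' hrel v v' x x' hx hty => ?_⟩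
    choose a ha using fun m => hvar (ts m)
    obtain rfl : ts = fun m => .var (.inr (a m)) := funext ha
    obtain ⟨i⟩ := R
    have := hrel hty i fun m => ((x (a m)).1.1, a m)
    simp only [hx] at this
    refine Iff.trans ?_ this
    simp only [← hx]
    exact Iff.rfl
  | imp φ ψ ihφ ihψ =>
    obtain ⟨N, hN⟩ := ihφ
    obtain ⟨M, hM⟩ := ihψ
    refine ⟨max N M, fun q hq r ρ ρ' S T T' hr hr' hT hT' hrel v v' x x' hx hty => ?_⟩
    exact imp_congr
      (hN q (le_of_max_le_left hq) hr hr' hT hT' hrel v v' x x' hx hty)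
      (hM q (le_of_max_le_right hq) hr hr' hT hT' hrel v v' x x' hx hty)
  | @all n φ ih =>
    obtain ⟨N, hN⟩ := ih
    refine ⟨N + 1, fun q hq r ρ ρ' S T T' hr hr' hT hT' hrel v v' x x' hx hty => ?_⟩
    obtain ⟨q, rfl⟩ := Nat.exists_eq_add_of_le' (Nat.le_of_add_left_le hq)
    have hq' : N ≤ q := Nat.le_of_add_le_add_right hq
    have hsnoc : ∀ {U : PairStr τ S} (x : Fin n → U.toFinStr) (e : U.toFinStr),
        (fun l => ((Fin.snoc x e : Fin (n + 1) → U.toFinStr) l).1.2) =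
          (Fin.snoc (fun l => (x l).1.2) e.1.2 : Fin (n + 1) → ℕ) := fun x e => by
      funext l
      induction l using Fin.lastCases <;> simp
    have hfst : ∀ (e : T.toFinStr) (e' : T'.toFinStr), e.1.1 = e'.1.1 → ∀ l,
        ((Fin.snoc x e : Fin (n + 1) → T.toFinStr) l).1.1 =
          ((Fin.snoc x' e' : Fin (n + 1) → T'.toFinStr) l).1.1 := fun e e' he l => by
      induction l using Fin.lastCases <;> simp [he, hx]
    constructor
    · intro H e'
      have he' : e'.1 ∈ targetUniv ρ' S := hT' ▸ e'.2
      -- The answer to `(A, j')` is `(A, j)`. It exists in `T` because membership of the pair is an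
      -- atomic statement about the label.
      obtain ⟨j, -, hj⟩ := exists_labelType_snoc_eq hty.symm
        (snd_mem_labels_of_mem_targetUniv he')
      have hmem := mem_targetUniv_of_labelType_eq hj hr' (S := S) (A := e'.1.1) (a := Fin.last n)
        (by simpa using he')
      rw [Fin.snoc_last, ← hT] at hmem
      exact (hN q hq' hr hr' hT hT' hrel v v' (Fin.snoc x ⟨_, hmem⟩) (Fin.snoc x' e')
        (hfst _ _ rfl) ((congrArg _ (hsnoc _ _)).trans (hj.symm.trans (congrArg _ (hsnoc _ _)).symm))).1 (H _)
    · intro H e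
      have he : e.1 ∈ targetUniv ρ S := hT ▸ e.2
      obtain ⟨j, -, hj⟩ := exists_labelType_snoc_eq hty (snd_mem_labels_of_mem_targetUniv he)
      have hmem := mem_targetUniv_of_labelType_eq hj hr (S := S) (A := e.1.1) (a := Fin.last n)
        (by simpa using he)
      rw [Fin.snoc_last, ← hT'] at hmem
      exact (hN q hq' hr hr' hT hT' hrel v v' (Fin.snoc x e) (Fin.snoc x' ⟨_, hmem⟩)
        (hfst _ _ rfl) ((congrArg _ (hsnoc _ _)).trans (hj.trans (congrArg (labelType r ρ' q) (hsnoc x' ⟨_, hmem⟩)).symm))).2 (H _)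

/-- Whether a cookbook reduction of bounded arity is a reduction to an FO-definable problem only
depends on its back-and-forth type of a fixed depth. -/
theorem exists_depth_isReduction (σ : Schema) (r : ℕ) (Q : Problem τ) (hQ : Q.FODefinable) :
    ∃ N, ∀ (P : Problem σ) (ρ ρ' : Set (Instruction σ τ)),
      IsCookbookReduction ρ → IsCookbookReduction ρ' → ArityLE ρ r → ArityLE ρ' r →
      labelType r ρ N (Fin.elim0 : Fin 0 → ℕ) = labelType r ρ' N Fin.elim0 →
      IsReduction ρ P Q → IsReduction ρ' P Q := by
  obtain ⟨φ, hφ⟩ := hQ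
  obtain ⟨N, hN⟩ := exists_depth (σ := σ) φ
  -- `N` is the depth for the game on targets; the maximal arity is the depth for the overlaps.
  refine ⟨max N (Finset.univ.sup τ.ar), fun P ρ ρ' hρ hρ' hr hr' h H S T' hT' => ?_⟩
  obtain ⟨T, hT⟩ := (hρ.p5 S).1
  obtain ⟨U, hU, hrel⟩ := exists_produces_of_labelType_eq hρ hρ' hr hr' h
    (fun i => (Finset.le_sup (Finset.mem_univ i)).trans (le_max_right _ _)) hT
  have hTU : T.toFinStr ∈ Q.instances ↔ U.toFinStr ∈ Q.instances := by
    rw [hφ, hφ]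
    exact hN _ (le_max_left _ _) hr hr' hT.univ_eq hU.univ_eq hrel _ _ _ _ (fun l => l.elim0)
      (by convert h)
  have hiso := (hρ'.p5 S).2
  exact (H S T hT).trans (hTU.trans
    ⟨Q.iso_closed _ _ (hiso _ _ hU hT'), Q.iso_closed _ _ (hiso _ _ hT' hU)⟩)

end Transfer

end Cookbook

/-! ### The decision procedure -/

theorem mainTheorem1 (σ τ : Cookbook.Schema) (r : ℕ) (hr : 0 < r)
    (P : Cookbook.Problem σ) (Q : Cookbook.Problem τ) (hQ : Q.FODefinable) :
    ∃ f : Cookbook.ReductionCode → Bool, Computable f ∧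
      ∀ c : Cookbook.ReductionCode,
        Cookbook.IsCookbookReduction (Cookbook.ReductionCode.decode σ τ c) →
        Cookbook.ArityLE (Cookbook.ReductionCode.decode σ τ c) r →
        (f c = true ↔ Cookbook.IsReduction (Cookbook.ReductionCode.decode σ τ c) P Q) := by
  classical
  obtain ⟨N, hN⟩ := Cookbook.exists_depth_isReduction σ r Q hQ
  -- The table: type `v` is accepted if some cookbook reduction of type `v` and arity at most `r`
  -- reduces `P` to `Q`. Each entry is a constant proposition.
  have hf := PrimrecPred.exists_finite (ι := Cookbook.LabelType σ τ r N 0) fun v =>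
    (Cookbook.primrecPred_labelType_eq N Primrec.id (xs := Fin.elim0)
      (fun l => l.elim0) v).and (PrimrecPred.constProp (∃ ρ, Cookbook.IsCookbookReduction ρ ∧
        Cookbook.ArityLE ρ r ∧ Cookbook.IsReduction ρ P Q ∧
        Cookbook.labelType r ρ N (Fin.elim0 : Fin 0 → ℕ) = v))
  refine ⟨_, hf.decide.to_comp, fun c hc hcr => ?_⟩
  rw [decide_eq_true_iff]
  constructor
  · rintro ⟨v, hv, ρ, hρ, hρr, hρP, rfl⟩
    refine hN P ρ _ hρ hc hρr hcr ?_ hρP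
    rw [← hv]
    exact congrArg _ (Subsingleton.elim _ _)
  · intro h
    refine ⟨_, rfl, _, hc, hcr, h, ?_⟩
    exact congrArg _ (Subsingleton.elim _ _)
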